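/- Let $\mathbb{F}$ be a field, let $a,b\in\mathbb{F}$, and let $\mathbb{H}=\mathbb{H}(a,b)$ be the quaternion algebra over $\mathbb{F}$ with basis $1,i,j,k$ and multiplication $i^2=a$, $j^2=b$, $ij=k$, $ji=-k$, with conjugation $\overline{x_0+x_1i+x_2j+x_3k}=x_0-x_1i-x_2j-x_3k$. Let $n\ge 1$. For an $n\times n$ matrix $A$ over $\mathbb{H}$ let $A^*$ be its conjugate transpose. For a permutation $\sigma\in S_n$ and an index $m$ whose cycle under $\sigma$ has length $l$, put $$A_\sigma(m)=a_{m,\sigma(m)}\,a_{\sigma(m),\sigma^2(m)}\cdots a_{\sigma^{l-1}(m),m}.$$ Given an index $p$, let $m_2<\dots<m_r$ be the smallest elements of the cycles of $\sigma$ (fixed points included) that do not contain $p$. The $p$-th row and column determinants of $A$ are $$\operatorname{rdet}_p A=\sum_{\sigma\in S_n}(-1)^{n-r}A_\sigma(p)\,A_\sigma(m_2)\cdots A_\sigma(m_r),\qquad \operatorname{cdet}_p A=\sum_{\sigma\in S_n}(-1)^{n-r}A_\sigma(m_r)\cdots A_\sigma(m_2)\,A_\sigma(p).$$ The double determinant of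 $A$ is $\operatorname{ddet}A=\det(AA^*):=\operatorname{rdet}_1(AA^*)$. For $1\le p,q\le n$, the left double $pq$-th cofactor $\mathbb{L}_{pq}$ of $A$ is $\operatorname{cdet}_q$ of the matrix obtained from $A^*A$ by replacing its $q$-th column with the $p$-th column of $A^*$, and the right double $pq$-th cofactor $\mathbb{R}_{pq}$ of $A$ is $\operatorname{rdet}_p$ of the matrix obtained from $AA^*$ by replacing its $p$-th row with the $q$-th row of $A^*$. If $\operatorname{ddet}A\neq 0$, then $\mathbb{L}_{pq}=\mathbb{R}_{pq}$ for all $p,q\in\{1,\dots,n\}$. -/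

import Mathlib

open scoped Quaternion Matrix

noncomputable section

namespace Matrix

variable {R : Type*} {n : ℕ}

/-- The ordered product along the cycle of `σ` through `k`, started at `k`:
`a_{k, σ k} * a_{σ k, σ² k} * ⋯ * a_{σ⁻¹ k, k}` (just `a_{k,k}` if `k` is a fixed point). -/
def cycleProd [Ring R] (A : Matrix (Fin n) (Fin n) R) (σ : Equiv.Perm (Fin n)) (k : Fin n) : R :=
  ((List.range (Function.minimalPeriod σ k)).map
    fun t => A ((σ ^ t) k) ((σ ^ (t + 1)) k)).prod

/-- The smallest elements of those cycles of `σ` (fixed points included) that do not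
contain `i`, listed in increasing order. -/
def otherCycleMins (σ : Equiv.Perm (Fin n)) (i : Fin n) : List (Fin n) :=
  (Finset.univ.filter fun m : Fin n =>
    ¬ σ.SameCycle i m ∧ ∀ l : Fin n, σ.SameCycle m l → m ≤ l).sort (· ≤ ·)

/-- The `i`-th row determinant. In the monomial of `σ` the cycle through `i` comes first and
starts at `i`; the other cycles follow, each started at its smallest element, in increasing order
of these smallest elements. The sign of `σ` is `(-1)^(n-r)`, with `r` the number of cycles of `σ`,
fixed points included. -/
def rdet [Ring R] (i : Fin n) (A : Matrix (Fin n) (Fin n) R) : R :=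
  ∑ σ : Equiv.Perm (Fin n), (Equiv.Perm.sign σ : ℤ) •
    (cycleProd A σ i * ((otherCycleMins σ i).map (cycleProd A σ)).prod)

/-- The `j`-th column determinant. In the monomial of `τ` the cycle through `j` stands last
(rightmost) and contributes `a_{j, τ j} * ⋯ * a_{τ⁻¹ j, j}`; to its left stand the other cycles,
in increasing order of their smallest elements when read from right to left, and the cycle with
smallest element `m` contributes `a_{m, τ m} * ⋯ * a_{τ⁻¹ m, m}`. -/
def cdet [Ring R] (j : Fin n) (A : Matrix (Fin n) (Fin n) R) : R :=
  ∑ τ : Equiv.Perm (Fin n), (Equiv.Perm.sign τ : ℤ) •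
    (((otherCycleMins τ j).reverse.map (cycleProd A τ)).prod * cycleProd A τ j)

/-- The determinant of a Hermitian matrix, as its first row determinant (for Hermitian matrices
over a quaternion algebra all row and column determinants agree). -/
def hermitianDet [Ring R] [NeZero n] (A : Matrix (Fin n) (Fin n) R) : R :=
  rdet 0 A

/-- The double determinant `ddet A = det (A A*)`. -/
def ddet [Ring R] [StarRing R] [NeZero n] (A : Matrix (Fin n) (Fin n) R) : R :=
  hermitianDet (A * Aᴴ)

/-- The left double `ij`-th cofactor: `cdet_j` of `A* A` with its `j`-th column replaced by the
`i`-th column of `A*`. -/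
def leftDoubleCofactor [Ring R] [StarRing R] (A : Matrix (Fin n) (Fin n) R) (i j : Fin n) : R :=
  cdet j ((Aᴴ * A).updateCol j (fun k => Aᴴ k i))

/-- The right double `ij`-th cofactor: `rdet_i` of `A A*` with its `i`-th row replaced by the
`j`-th row of `A*`. -/
def rightDoubleCofactor [Ring R] [StarRing R] (A : Matrix (Fin n) (Fin n) R) (i j : Fin n) : R :=
  rdet i ((A * Aᴴ).updateRow i (fun k => Aᴴ j k))

end Matrix

end

/-! Write `H = A * Aᴴ`, `K = Aᴴ * A`, and let `d` be the Moore determinant, the signed sum over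
permutations of the products of real parts of cycle products. Row expansion gives `R_pq = (Aᴴ * adj
H)_qp` and, after conjugation, `L_pq = ((adj K)ᴴ * Aᴴ)_qp`, where `adj` is `rowAdjugate`. Since `H *
adj H = d(H)` and `(adj K)ᴴ * K = d(K)`, evaluating `(adj K)ᴴ * Aᴴ * A * Aᴴ * adj H` in two ways
yields `d(K) • (Aᴴ * adj H) = d(H) • ((adj K)ᴴ * Aᴴ)`. It remains to see that `d(H) = d(K)`, which
is nonzero by hypothesis.

The identity `IsScalarHermitian.mul_rowAdjugate` rests on reversing one cycle of a permutation: the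
sign stays, and for a Hermitian matrix the product along the cycle is conjugated. Summation
therefore turns cycle factors into their real parts. Hence every row determinant equals the scalar
`d` (`IsScalarHermitian.rdet_eq`). When row `i` repeats row `k`, pairing `σ` with `σ * swap i k`
makes the row determinant vanish (`IsScalarHermitian.rdet_updateRow_eq_zero`).

For `d(H) = d(K)`: `H * A = A * K`, and `A` has the right inverse `d(H)⁻¹ • (Aᴴ * adj H)`, so
invariance under similarity suffices (`IsScalarHermitian.mooreDet_eq_of_similar`). The determinant
`N` of the regular representation is multiplicative, and `N = d ^ 4` when suitable minors do not
vanish. Along the line joining a matrix to the identity both facts hold over `F[X]`; two polynomials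
with equal fourth powers that both take the value 1 at the identity coincide. -/

namespace Equiv.Perm

/-! ### Permutations that agree on a cycle -/

variable {α : Type*} {f g : Perm α} {x : α}

lemma inv_apply_apply (f : Perm α) (x : α) : f⁻¹ (f x) = x := f.symm_apply_apply x

lemma apply_inv_apply (f : Perm α) (x : α) : f (f⁻¹ x) = x := f.apply_symm_apply x

lemma pow_apply_congr_of_sameCycle (h : ∀ y, f.SameCycle x y → g y = f y) (t : ℕ) :
    (g ^ t) x = (f ^ t) x := by
  induction t with
  | zero => rfl
  | succ t ih =>
    rw [pow_succ', pow_succ', mul_apply, mul_apply, ih]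
    exact h _ ⟨t, by simp⟩

lemma sameCycle_of_pow_apply_eq {y : α} {t : ℕ} (h : (f ^ t) x = y) : f.SameCycle x y :=
  ⟨t, by simpa using h⟩

lemma sameCycle_congr [Finite α] (h : ∀ y, f.SameCycle x y → g y = f y) (y : α) :
    g.SameCycle x y ↔ f.SameCycle x y := by
  constructor
  · intro hy
    obtain ⟨t, -, ht⟩ := hy.exists_pow_eq'
    rw [pow_apply_congr_of_sameCycle h] at ht
    exact ⟨t, by simpa using ht⟩
  · intro hy
    obtain ⟨t, -, ht⟩ := hy.exists_pow_eq'
    rw [← pow_apply_congr_of_sameCycle h] at ht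
    exact ⟨t, by simpa using ht⟩

lemma isPeriodicPt_iff_pow (f : Perm α) (t : ℕ) (x : α) :
    Function.IsPeriodicPt f t x ↔ (f ^ t) x = x := by
  rw [Function.IsPeriodicPt, Function.IsFixedPt, iterate_eq_pow]

lemma minimalPeriod_congr_of_sameCycle (h : ∀ y, f.SameCycle x y → g y = f y) :
    Function.minimalPeriod g x = Function.minimalPeriod f x := by
  rw [Function.minimalPeriod_eq_minimalPeriod_iff]
  intro t
  rw [isPeriodicPt_iff_pow, isPeriodicPt_iff_pow, pow_apply_congr_of_sameCycle h]

lemma minimalPeriod_inv (f : Perm α) (x : α) :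
    Function.minimalPeriod ⇑f⁻¹ x = Function.minimalPeriod f x := by
  rw [Function.minimalPeriod_eq_minimalPeriod_iff]
  intro t
  rw [isPeriodicPt_iff_pow, isPeriodicPt_iff_pow, inv_pow, inv_eq_iff_eq]
  exact eq_comm

lemma pow_minimalPeriod_apply (f : Perm α) (x : α) : (f ^ Function.minimalPeriod f x) x = x :=
  (isPeriodicPt_iff_pow f _ x).1 (Function.isPeriodicPt_minimalPeriod f x)

lemma minimalPeriod_pos [Finite α] (f : Perm α) (x : α) : 0 < Function.minimalPeriod f x := by
  apply Function.minimalPeriod_pos_of_mem_periodicPts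
  refine ⟨orderOf f, orderOf_pos f, ?_⟩
  rw [isPeriodicPt_iff_pow, pow_orderOf_eq_one, one_apply]

/-! ### Reversing one cycle of a permutation -/

section flip

variable [Fintype α] [DecidableEq α]

/-- The permutation `f` with the cycle through `m` reversed. -/
def flipCycle (f : Perm α) (m : α) : Perm α := f * (f.cycleOf m)⁻¹ * (f.cycleOf m)⁻¹

lemma flipCycle_apply_of_sameCycle {m : α} (h : f.SameCycle m x) : f.flipCycle m x = f⁻¹ x := by
  have h1 : (f⁻¹).SameCycle m x := sameCycle_inv.2 h
  have h2 : (f⁻¹).SameCycle m (f⁻¹ x) := sameCycle_apply_right.2 h1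
  rw [flipCycle, mul_apply, mul_apply, cycleOf_inv, SameCycle.cycleOf_apply h1,
    SameCycle.cycleOf_apply h2, apply_inv_apply]

lemma flipCycle_apply_of_not_sameCycle {m : α} (h : ¬ f.SameCycle m x) :
    f.flipCycle m x = f x := by
  have h1 : ¬ (f⁻¹).SameCycle m x := fun h' => h (sameCycle_inv.1 h')
  rw [flipCycle, mul_apply, mul_apply, cycleOf_inv, cycleOf_apply_of_not_sameCycle h1,
    cycleOf_apply_of_not_sameCycle h1]

/-- The inverse of the cycle enters squared, so it contributes no sign. -/
lemma sign_flipCycle (f : Perm α) (m : α) : sign (f.flipCycle m) = sign f := by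
  rw [flipCycle, sign_mul, sign_mul, mul_assoc, Int.units_mul_self, mul_one]

lemma flipCycle_eq_of_sameCycle {m : α} (hx : f.SameCycle m x) (y : α) (hy : f.SameCycle x y) :
    f.flipCycle m y = f⁻¹ y :=
  flipCycle_apply_of_sameCycle (hx.trans hy)

lemma flipCycle_eq_of_not_sameCycle {m : α} (hx : ¬ f.SameCycle m x) (y : α)
    (hy : f.SameCycle x y) : f.flipCycle m y = f y :=
  flipCycle_apply_of_not_sameCycle fun h => hx (h.trans hy.symm)

lemma sameCycle_flipCycle (f : Perm α) (m x y : α) :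
    (f.flipCycle m).SameCycle x y ↔ f.SameCycle x y := by
  by_cases hx : f.SameCycle m x
  · rw [sameCycle_congr (f := f⁻¹), sameCycle_inv]
    intro y hy
    exact flipCycle_eq_of_sameCycle hx y (sameCycle_inv.1 hy)
  · exact sameCycle_congr (flipCycle_eq_of_not_sameCycle hx) y

lemma flipCycle_inv_apply_of_sameCycle {m : α} (h : f.SameCycle m x) :
    (f.flipCycle m)⁻¹ x = f x := by
  rw [inv_eq_iff_eq, flipCycle_apply_of_sameCycle (sameCycle_apply_right.2 h), inv_apply_apply]

lemma flipCycle_flipCycle (f : Perm α) (m : α) : (f.flipCycle m).flipCycle m = f := by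
  ext x
  by_cases h : f.SameCycle m x
  · rw [flipCycle_apply_of_sameCycle ((sameCycle_flipCycle ..).2 h),
      flipCycle_inv_apply_of_sameCycle h]
  · rw [flipCycle_apply_of_not_sameCycle (mt (sameCycle_flipCycle ..).1 h),
      flipCycle_apply_of_not_sameCycle h]

end flip

end Equiv.Perm

namespace Matrix
open Equiv

/-! ### Products of entries along orbits, and merging of cycles -/

section walk
variable {n : ℕ} {S : Type*} [Ring S]

/-- The product of the entries of `A` along the first `t` steps of the orbit of `x`. -/
def walkProd (A : Matrix (Fin n) (Fin n) S) (σ : Perm (Fin n)) (x : Fin n) (t : ℕ) : S :=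
  ((List.range t).map fun s => A ((σ ^ s) x) ((σ ^ (s + 1)) x)).prod

variable (A : Matrix (Fin n) (Fin n) S) (σ : Perm (Fin n)) (x : Fin n)

lemma cycleProd_eq_walkProd : cycleProd A σ x = walkProd A σ x (Function.minimalPeriod σ x) := rfl

@[simp] lemma walkProd_zero : walkProd A σ x 0 = 1 := rfl

lemma walkProd_succ (t : ℕ) :
    walkProd A σ x (t + 1) = walkProd A σ x t * A ((σ ^ t) x) ((σ ^ (t + 1)) x) := by
  simp [walkProd, List.range_succ]

lemma walkProd_add (t s : ℕ) :
    walkProd A σ x (t + s) = walkProd A σ x t * walkProd A σ ((σ ^ t) x) s := by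
  induction s with
  | zero => simp
  | succ s ih =>
    rw [← add_assoc, walkProd_succ, ih, walkProd_succ, mul_assoc]
    simp only [← Perm.mul_apply, ← pow_add]
    congr 3 <;> ring_nf

lemma walkProd_succ' (t : ℕ) :
    walkProd A σ x (t + 1) = A x (σ x) * walkProd A σ (σ x) t := by
  rw [add_comm, walkProd_add, walkProd_succ]
  simp

lemma walkProd_congr {A B : Matrix (Fin n) (Fin n) S} {σ τ : Perm (Fin n)} {x y : Fin n} {t : ℕ}
    (h : ∀ s < t, B ((τ ^ s) y) ((τ ^ (s + 1)) y) = A ((σ ^ s) x) ((σ ^ (s + 1)) x)) :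
    walkProd B τ y t = walkProd A σ x t := by
  unfold walkProd
  congr 1
  apply List.map_congr_left
  intro s hs
  exact h s (List.mem_range.1 hs)

lemma cycleProd_congr {A B : Matrix (Fin n) (Fin n) S} {σ τ : Perm (Fin n)} {x : Fin n}
    (h : ∀ y, σ.SameCycle x y → τ y = σ y)
    (hAB : ∀ y, σ.SameCycle x y → B y (σ y) = A y (σ y)) :
    cycleProd B τ x = cycleProd A σ x := by
  rw [cycleProd_eq_walkProd, cycleProd_eq_walkProd, Perm.minimalPeriod_congr_of_sameCycle h]
  apply walkProd_congr
  intro s _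
  rw [Perm.pow_apply_congr_of_sameCycle h, Perm.pow_apply_congr_of_sameCycle h, pow_succ',
    Perm.mul_apply]
  exact hAB _ ⟨s, by simp⟩

lemma map_cycleProd {T : Type*} [Ring T] (f : S →+* T) :
    cycleProd (A.map f) σ x = f (cycleProd A σ x) := by
  simp [cycleProd, map_list_prod, List.map_map, Function.comp_def]

lemma star_walkProd [StarRing S] (t : ℕ) :
    star (walkProd A σ x t) = walkProd Aᴴ σ⁻¹ ((σ ^ t) x) t := by
  induction t with
  | zero => simp
  | succ t ih =>
    rw [walkProd_succ, star_mul, ih, walkProd_succ', pow_succ', Perm.mul_apply, Perm.inv_apply_apply,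
      conjTranspose_apply]

lemma cycleProd_conjTranspose_inv [StarRing S] :
    cycleProd Aᴴ σ⁻¹ x = star (cycleProd A σ x) := by
  rw [cycleProd_eq_walkProd, cycleProd_eq_walkProd, star_walkProd, Perm.minimalPeriod_inv,
    Perm.pow_minimalPeriod_apply]

lemma walkProd_eq_walkProd_pred_mul {p : ℕ} (hp : 0 < p) (h : (σ ^ p) x = x) :
    walkProd A σ (σ x) p = walkProd A σ (σ x) (p - 1) * A x (σ x) := by
  obtain ⟨q, rfl⟩ := Nat.exists_eq_succ_of_ne_zero hp.ne'
  rw [Nat.succ_eq_add_one, walkProd_succ, Nat.add_sub_cancel]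
  rw [← Perm.mul_apply, ← pow_succ, h, ← Perm.mul_apply, ← pow_succ, pow_succ' σ (q+1),
    Perm.mul_apply, h]

/-- Moving the starting point one step along the cycle carries the first factor to the end. Traces,
here real parts, do not see this. -/
lemma exists_cycleProd_eq_mul : ∃ u v : S,
    cycleProd A σ x = u * v ∧ cycleProd A σ (σ x) = v * u := by
  have hp := Perm.minimalPeriod_pos σ x
  have hm : Function.minimalPeriod σ (σ x) = Function.minimalPeriod σ x :=
    Function.minimalPeriod_apply (Function.minimalPeriod_pos_iff_mem_periodicPts.1 hp)
  refine ⟨A x (σ x), walkProd A σ (σ x) (Function.minimalPeriod σ x - 1), ?_, ?_⟩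
  · rw [cycleProd_eq_walkProd, ← walkProd_succ', Nat.sub_add_cancel hp]
  · rw [cycleProd_eq_walkProd, hm,
      walkProd_eq_walkProd_pred_mul A σ x hp (Perm.pow_minimalPeriod_apply σ x)]

lemma pow_mul_swap_apply_of_forall_ne {σ : Perm (Fin n)} {i k : Fin n} {s : ℕ}
    (h : ∀ r, 0 < r → r ≤ s → (σ ^ r) k ≠ i ∧ (σ ^ r) k ≠ k) :
    ((σ * Equiv.swap i k) ^ (s + 1)) i = (σ ^ (s + 1)) k := by
  induction s with
  | zero => simp
  | succ s ih =>
    have hs := h (s + 1) (Nat.succ_pos s) le_rfl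
    rw [pow_succ', Perm.mul_apply, ih fun r h0 hr => h r h0 (by lia), pow_succ' σ (s + 1),
      Perm.mul_apply, Perm.mul_apply, Equiv.swap_apply_of_ne_of_ne hs.1 hs.2]

/-- Multiplying by a transposition merges two distinct cycles. -/
lemma pow_mul_swap_apply {σ : Perm (Fin n)} {i k : Fin n} (h : ¬ σ.SameCycle i k) {s : ℕ}
    (hs : s < Function.minimalPeriod σ k) :
    ((σ * Equiv.swap i k) ^ (s + 1)) i = (σ ^ (s + 1)) k := by
  refine pow_mul_swap_apply_of_forall_ne fun r h0 hr => ⟨fun e => ?_, fun e => ?_⟩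
  · exact h (Perm.sameCycle_of_pow_apply_eq e).symm
  · have := ((Perm.isPeriodicPt_iff_pow σ r k).2 e).minimalPeriod_le h0
    lia

lemma pow_mul_swap_apply_minimalPeriod {σ : Perm (Fin n)} {i k : Fin n} (h : ¬ σ.SameCycle i k) :
    ((σ * Equiv.swap i k) ^ (Function.minimalPeriod σ k)) i = k := by
  have hp := Perm.minimalPeriod_pos σ k
  have := pow_mul_swap_apply h (Nat.sub_one_lt hp.ne')
  rwa [Nat.sub_add_cancel (Nat.succ_le_of_lt hp), Perm.pow_minimalPeriod_apply] at this

/-- The new permutation sends `i` to `σ k`: its orbit runs through the old cycle of `k`, arrives at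
`k`, jumps to `σ i` and runs through the old cycle of `i`. -/
lemma minimalPeriod_mul_swap {σ : Perm (Fin n)} {i k : Fin n} (h : ¬ σ.SameCycle i k) :
    Function.minimalPeriod ⇑(σ * Equiv.swap i k) i =
      Function.minimalPeriod σ k + Function.minimalPeriod σ i := by
  have hi := Perm.minimalPeriod_pos σ i
  have hk := Perm.minimalPeriod_pos σ k
  have h' : ¬ σ.SameCycle k i := fun e => h e.symm
  have h1 := pow_mul_swap_apply_minimalPeriod h
  have h2 : ∀ s < Function.minimalPeriod σ i,
      ((σ * Equiv.swap i k) ^ (s + 1 + Function.minimalPeriod σ k)) i = (σ ^ (s + 1)) i := by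
    intro s hs
    rw [pow_add, Perm.mul_apply, h1, Equiv.swap_comm]
    exact pow_mul_swap_apply h' hs
  apply le_antisymm
  · apply Function.IsPeriodicPt.minimalPeriod_le (by lia)
    rw [Perm.isPeriodicPt_iff_pow]
    have := h2 _ (Nat.sub_one_lt hi.ne')
    rw [Nat.sub_add_cancel (Nat.succ_le_of_lt hi), Perm.pow_minimalPeriod_apply] at this
    rwa [add_comm]
  -- A return to `i` before that time would happen either in the second stretch, contradicting the
  -- period of `i`, or in the first, putting `i` on the cycle of `k`.
  · by_contra! hlt
    have hp := Perm.minimalPeriod_pos (σ * Equiv.swap i k) i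
    have hper := Perm.pow_minimalPeriod_apply (σ * Equiv.swap i k) i
    generalize Function.minimalPeriod ⇑(σ * Equiv.swap i k) i = q at hlt hp hper
    rcases Nat.lt_or_ge (Function.minimalPeriod σ k) q with hq | hq
    · obtain ⟨s, rfl⟩ : ∃ s, q = s + 1 + Function.minimalPeriod σ k :=
        ⟨q - 1 - Function.minimalPeriod σ k, by lia⟩
      rw [h2 s (by lia)] at hper
      have := ((Perm.isPeriodicPt_iff_pow σ (s + 1) i).2 hper).minimalPeriod_le (Nat.succ_pos s)
      lia
    · obtain ⟨s, rfl⟩ : ∃ s, q = s + 1 := ⟨q - 1, by lia⟩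
      rw [pow_mul_swap_apply h (by lia)] at hper
      exact h' (Perm.sameCycle_of_pow_apply_eq hper)

lemma walkProd_mul_swap {A B : Matrix (Fin n) (Fin n) S} {σ : Perm (Fin n)} {i k : Fin n}
    (h : ¬ σ.SameCycle i k) (h0 : B i (σ k) = A k (σ k))
    (hAB : ∀ y, y ≠ i → y ≠ k → B y = A y) :
    walkProd B (σ * Equiv.swap i k) i (Function.minimalPeriod σ k) = cycleProd A σ k := by
  rw [cycleProd_eq_walkProd]
  apply walkProd_congr
  intro s hs
  rw [pow_mul_swap_apply h hs]
  cases s with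
  | zero => simpa using h0
  | succ s =>
    rw [pow_mul_swap_apply h (by lia)]
    rw [hAB]
    · intro e
      exact h (Perm.SameCycle.symm (Perm.sameCycle_of_pow_apply_eq e))
    · intro e
      have := ((Perm.isPeriodicPt_iff_pow σ (s + 1) k).2 e).minimalPeriod_le (Nat.succ_pos s)
      lia

/-- The merged cycle uses the entries of the two old cycles, except that `i` and `k` exchange
successors; equality of their rows makes this invisible. -/
lemma cycleProd_mul_swap {A : Matrix (Fin n) (Fin n) S} {σ : Perm (Fin n)} {i k : Fin n}
    (h : ¬ σ.SameCycle i k) (hA : A i = A k) :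
    cycleProd A (σ * Equiv.swap i k) i = cycleProd A σ k * cycleProd A σ i := by
  have h' : ¬ σ.SameCycle k i := fun e => h e.symm
  rw [cycleProd_eq_walkProd, minimalPeriod_mul_swap h, walkProd_add,
    pow_mul_swap_apply_minimalPeriod h, walkProd_mul_swap (A := A) h (by rw [hA]) (fun _ _ _ => rfl),
    Equiv.swap_comm, walkProd_mul_swap (A := A) h' (by rw [hA]) (fun _ _ _ => rfl)]

end walk

/-! ### Replacing factors by real parts in sums over an involution -/

section quaternion
variable {R : Type*} [CommRing R] {a b : R}

lemma quaternion_add_star (x : ℍ[R, a, b]) : x + star x = (x.re : ℍ[R, a, b]) + (star x).re := by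
  ext <;> simp

lemma quaternion_re_mul_comm (x y : ℍ[R, a, b]) : (x * y).re = (y * x).re := by
  simp; ring

lemma quaternion_mul_star_eq_coe (x : ℍ[R, a, b]) : x * star x = ((x * star x).re : ℍ[R, a, b]) := by
  ext <;> simp <;> ring

/-- An involution that conjugates one factor and preserves the others replaces, in a sum,
this factor by its real part. -/
lemma sum_mul_eq_sum_mul_re {Ω : Type*} [Fintype Ω] [DecidableEq Ω] (φ : Ω → Ω)
    (hφ : ∀ σ, φ (φ σ) = σ) (P x Q : Ω → ℍ[R, a, b]) (hP : ∀ σ, P (φ σ) = P σ)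
    (hQ : ∀ σ, Q (φ σ) = Q σ) (hx : ∀ σ, x (φ σ) = star (x σ))
    (hfix : ∀ σ, φ σ = σ → x σ = ((x σ).re : ℍ[R, a, b])) :
    ∑ σ, P σ * x σ * Q σ = ∑ σ, P σ * ((x σ).re : ℍ[R, a, b]) * Q σ := by
  rw [← sub_eq_zero, ← Finset.sum_sub_distrib]
  -- The terms with `x - re x` cancel in pairs, since `x + star x` is the sum of the two real parts.
  -- Nothing is divided by 2, so characteristic 2 is covered; fixed points are handled by `hfix`.
  refine Finset.sum_involution (fun σ _ => φ σ) ?_ ?_ (by simp) (fun σ _ => hφ σ)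
  · intro σ _
    rw [hP, hQ, hx]
    have h := sub_eq_zero.2 (quaternion_add_star (x σ))
    calc _ = P σ * (x σ + star (x σ) - ((x σ).re + (star (x σ)).re)) * Q σ := by noncomm_ring
      _ = 0 := by rw [h]; simp
  · intro σ _ hne he
    apply hne
    rw [← hfix σ he, sub_self]

/-- Induction on the list: the head is first absorbed into the prefix `P` while the tail becomes
scalar, and is then replaced in turn. -/
lemma sum_mul_prod_eq_sum_mul_prod_re {Ω ι : Type*} [Fintype Ω] [DecidableEq Ω] (L : List ι)
    (hL : L.Nodup) (φ : ι → Ω → Ω) (hφ : ∀ m σ, φ m (φ m σ) = σ) (x : Ω → ι → ℍ[R, a, b])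
    (hx : ∀ m σ, x (φ m σ) m = star (x σ m))
    (hx' : ∀ m k σ, k ≠ m → x (φ m σ) k = x σ k)
    (hfix : ∀ m σ, φ m σ = σ → x σ m = ((x σ m).re : ℍ[R, a, b]))
    (P : Ω → ℍ[R, a, b]) (hP : ∀ m ∈ L, ∀ σ, P (φ m σ) = P σ) :
    ∑ σ, P σ * (L.map (x σ)).prod =
      ∑ σ, P σ * ((L.map fun m => (x σ m).re).prod : R) := by
  induction L generalizing P with
  | nil => simp
  | cons m L ih =>
    have hm : m ∉ L := (List.nodup_cons.1 hL).1
    have h1 := ih (List.nodup_cons.1 hL).2 (fun σ => P σ * x σ m) (by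
      intro k hk σ
      rw [hP k (List.mem_cons_of_mem _ hk), hx' _ _ _ (by rintro rfl; exact hm hk)])
    have h2 := sum_mul_eq_sum_mul_re (φ m) (hφ m) P (fun σ => x σ m)
      (fun σ => (((L.map fun m => (x σ m).re).prod : R) : ℍ[R, a, b]))
      (hP m List.mem_cons_self) (by
        intro σ
        congr 2
        apply List.map_congr_left
        intro k hk
        rw [hx' _ _ _ (by rintro rfl; exact hm hk)]) (hx m) (hfix m)
    simp only [List.map_cons, List.prod_cons, ← mul_assoc, QuaternionAlgebra.coe_mul]
    exact h1.trans h2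

end quaternion

/-! ### The Moore determinant and the row determinants of Hermitian matrices -/

section cycles
variable {n : ℕ}

/-- `m` is the smallest element of its cycle. -/
def IsCycleMin (σ : Perm (Fin n)) (m : Fin n) : Prop := ∀ l : Fin n, σ.SameCycle m l → m ≤ l

lemma isCycleMin_congr {σ τ : Perm (Fin n)} {m : Fin n}
    (h : ∀ y, σ.SameCycle m y → τ y = σ y) : IsCycleMin τ m ↔ IsCycleMin σ m := by
  simp only [IsCycleMin, Perm.sameCycle_congr h]

lemma isCycleMin_flipCycle (σ : Perm (Fin n)) (m k : Fin n) :
    IsCycleMin (σ.flipCycle m) k ↔ IsCycleMin σ k := by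
  simp only [IsCycleMin, Perm.sameCycle_flipCycle]

lemma exists_sameCycle_isCycleMin (σ : Perm (Fin n)) (k : Fin n) :
    ∃ m, σ.SameCycle k m ∧ IsCycleMin σ m := by
  classical
  obtain ⟨m, hm, hmin⟩ := Finset.exists_min_image (Finset.univ.filter fun m => σ.SameCycle k m) id
    ⟨k, by simp [Perm.SameCycle.refl]⟩
  simp only [Finset.mem_filter, Finset.mem_univ, true_and, id] at hm hmin
  exact ⟨m, hm, fun l hl => hmin l (hm.trans hl)⟩

lemma IsCycleMin.eq {σ : Perm (Fin n)} {m k : Fin n} (hm : IsCycleMin σ m) (hk : IsCycleMin σ k)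
    (h : σ.SameCycle m k) : m = k :=
  le_antisymm (hm _ h) (hk _ h.symm)

variable {R : Type*} [CommRing R] {a b : R}

lemma re_cycleProd_sameCycle (A : Matrix (Fin n) (Fin n) ℍ[R, a, b]) {σ : Perm (Fin n)}
    {k m : Fin n} (h : σ.SameCycle k m) : (cycleProd A σ m).re = (cycleProd A σ k).re := by
  obtain ⟨t, -, rfl⟩ := h.exists_pow_eq'
  induction t with
  | zero => rfl
  | succ t ih =>
    rw [← ih (Perm.sameCycle_of_pow_apply_eq rfl), pow_succ', Perm.mul_apply]
    obtain ⟨u, v, h1, h2⟩ := exists_cycleProd_eq_mul A σ ((σ ^ t) k)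
    rw [h1, h2, quaternion_re_mul_comm]

open Classical in
/-- The product of the real parts of the cycle products over the cycles whose minimum
satisfies `T`. -/
noncomputable def cyclesRe (A : Matrix (Fin n) (Fin n) ℍ[R, a, b]) (T : Fin n → Prop) (σ : Perm (Fin n)) : R :=
  ∏ m with T m ∧ IsCycleMin σ m, (cycleProd A σ m).re

lemma cyclesRe_congr {A B : Matrix (Fin n) (Fin n) ℍ[R, a, b]} {T U : Fin n → Prop}
    {σ τ : Perm (Fin n)} (hTU : ∀ m, U m ↔ T m)
    (h : ∀ m, T m → ∀ y, σ.SameCycle m y → τ y = σ y)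
    (hAB : ∀ m, T m → ∀ y, σ.SameCycle m y → B y (σ y) = A y (σ y)) :
    cyclesRe B U τ = cyclesRe A T σ := by
  classical
  unfold cyclesRe
  apply Finset.prod_congr
  · ext m
    simp only [Finset.mem_filter, Finset.mem_univ, true_and, hTU]
    exact and_congr_right fun hm => isCycleMin_congr (h m hm)
  · intro m hm
    simp only [Finset.mem_filter, Finset.mem_univ, true_and] at hm
    rw [cycleProd_congr (h m hm.1) (hAB m hm.1)]

lemma cyclesRe_eq_mul (A : Matrix (Fin n) (Fin n) ℍ[R, a, b]) {T : Fin n → Prop}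
    {σ : Perm (Fin n)} {k : Fin n} (hT : ∀ m, σ.SameCycle k m → T m) :
    cyclesRe A T σ =
      (cycleProd A σ k).re * cyclesRe A (fun m => T m ∧ ¬ σ.SameCycle k m) σ := by
  classical
  obtain ⟨m, hm, hmin⟩ := exists_sameCycle_isCycleMin σ k
  unfold cyclesRe
  rw [← re_cycleProd_sameCycle A hm]
  refine Eq.trans ?_ (Finset.prod_insert (f := fun m => (cycleProd A σ m).re) (a := m) (by simp [hm]))
  apply Finset.prod_congr _ fun _ _ => rfl
  ext l
  simp only [Finset.mem_filter, Finset.mem_univ, true_and, Finset.mem_insert]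
  constructor
  · rintro ⟨h1, h2⟩
    by_cases h : σ.SameCycle k l
    · exact Or.inl (h2.eq hmin (h.symm.trans hm))
    · exact Or.inr ⟨⟨h1, h⟩, h2⟩
  · rintro (rfl | h)
    · exact ⟨hT _ hm, hmin⟩
    · exact ⟨h.1.1, h.2⟩

lemma cycleProd_flipCycle {A : Matrix (Fin n) (Fin n) ℍ[R, a, b]} {σ : Perm (Fin n)} {m : Fin n}
    (h : ∀ y, σ.SameCycle m y → star (A y (σ y)) = A (σ y) y) :
    cycleProd A (σ.flipCycle m) m = star (cycleProd A σ m) := by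
  rw [← cycleProd_conjTranspose_inv]
  apply cycleProd_congr
  · intro y hy
    exact Perm.flipCycle_apply_of_sameCycle (Perm.sameCycle_inv.1 hy)
  · intro y hy
    have := h (σ⁻¹ y) (Perm.sameCycle_inv.1 (Perm.sameCycle_apply_right.2 hy))
    rw [Perm.apply_inv_apply] at this
    exact this.symm

lemma cycleProd_flipCycle_of_not_sameCycle {A : Matrix (Fin n) (Fin n) ℍ[R, a, b]}
    {σ : Perm (Fin n)} {m k : Fin n} (h : ¬ σ.SameCycle m k) :
    cycleProd A (σ.flipCycle m) k = cycleProd A σ k :=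
  cycleProd_congr (Perm.flipCycle_eq_of_not_sameCycle h) fun _ _ => rfl

/-- A cycle equal to its reversal has length 1 or 2, so its product is a diagonal entry or a norm `x
* star x`. The diagonal must be assumed scalar: in characteristic 2 every quaternion here is its own
conjugate. -/
lemma cycleProd_eq_coe_of_flipCycle_eq {A : Matrix (Fin n) (Fin n) ℍ[R, a, b]} {σ : Perm (Fin n)}
    {m : Fin n} (h : ∀ y, σ.SameCycle m y → star (A y (σ y)) = A (σ y) y)
    (hd : A m m = ((A m m).re : ℍ[R, a, b])) (hσ : σ.flipCycle m = σ) :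
    cycleProd A σ m = ((cycleProd A σ m).re : ℍ[R, a, b]) := by
  have h2 : σ (σ m) = m := by
    have := Perm.flipCycle_apply_of_sameCycle (Perm.SameCycle.refl σ m)
    rw [hσ] at this
    rw [this, Perm.apply_inv_apply]
  have hp : Function.minimalPeriod σ m ∣ 2 := by
    apply Function.IsPeriodicPt.minimalPeriod_dvd
    rw [Perm.isPeriodicPt_iff_pow, pow_two, Perm.mul_apply, h2]
  rcases (Nat.dvd_prime Nat.prime_two).1 hp with hp | hp
  · have h1 : σ m = m := by
      have := Perm.pow_minimalPeriod_apply σ m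
      rwa [hp, pow_one] at this
    have : cycleProd A σ m = A m m := by
      rw [cycleProd_eq_walkProd, hp, walkProd_succ']
      simp [h1]
    rw [this]
    exact hd
  · have : cycleProd A σ m = A m (σ m) * star (A m (σ m)) := by
      rw [cycleProd_eq_walkProd, hp, walkProd_succ', walkProd_succ', h2, h m (Perm.SameCycle.refl ..)]
      simp
    rw [this]
    exact quaternion_mul_star_eq_coe _

lemma cyclesRe_flipCycle {A : Matrix (Fin n) (Fin n) ℍ[R, a, b]} {T U : Fin n → Prop}
    {σ : Perm (Fin n)} {m : Fin n} (hTU : ∀ m, U m ↔ T m) (hT : ∀ k, T k → ¬ σ.SameCycle m k) :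
    cyclesRe A U (σ.flipCycle m) = cyclesRe A T σ :=
  cyclesRe_congr hTU (fun k hk => Perm.flipCycle_eq_of_not_sameCycle (hT k hk))
    fun _ _ _ _ => rfl

/-- Padding with ones makes the index list independent of `σ`, as `sum_mul_prod_eq_sum_mul_prod_re`
requires. -/
lemma otherCycleMins_prod {S : Type*} [Ring S] (σ : Perm (Fin n)) (i : Fin n)
    (f : Fin n → S) [DecidablePred fun m => ¬ σ.SameCycle i m ∧ IsCycleMin σ m] :
    ((otherCycleMins σ i).map f).prod =
      ((List.finRange n).map fun m =>
        if ¬ σ.SameCycle i m ∧ IsCycleMin σ m then f m else 1).prod := by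
  have h : otherCycleMins σ i =
      (List.finRange n).filter fun m => ¬ σ.SameCycle i m ∧ IsCycleMin σ m := by
    apply List.Perm.eq_of_pairwise (le := (· ≤ ·)) (fun _ _ _ _ => le_antisymm)
    · exact Finset.pairwise_sort _ _
    · exact (List.pairwise_le_finRange n).filter _
    · unfold otherCycleMins
      rw [List.perm_ext_iff_of_nodup (Finset.sort_nodup ..) ((List.nodup_finRange n).filter _)]
      intro m
      simp only [Finset.mem_sort, Finset.mem_filter, Finset.mem_univ, true_and, List.mem_filter,
        List.mem_finRange, decide_eq_true_eq]
      rfl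
  rw [h]
  induction List.finRange n with
  | nil => simp
  | cons m L ih =>
    by_cases hm : ¬ σ.SameCycle i m ∧ IsCycleMin σ m
    · simp only [List.map_cons, List.prod_cons, if_pos hm, ← ih]
      rw [List.filter_cons_of_pos (by simpa using hm)]
      simp
    · simp only [List.map_cons, List.prod_cons, if_neg hm, ← ih]
      rw [List.filter_cons_of_neg (by simpa using hm), one_mul]

/-- In a row determinant all cycles but the first may be replaced by their real parts, if the
matrix is Hermitian with scalar diagonal outside the chosen row and column. -/
lemma rdet_eq_sum_mul_cyclesRe {A : Matrix (Fin n) (Fin n) ℍ[R, a, b]} {i : Fin n}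
    (h : ∀ p q, p ≠ i → q ≠ i → star (A p q) = A q p)
    (hd : ∀ p, p ≠ i → A p p = ((A p p).re : ℍ[R, a, b])) :
    rdet i A = ∑ σ : Perm (Fin n), (Perm.sign σ : ℤ) •
      (cycleProd A σ i * ((cyclesRe A (fun m => ¬ σ.SameCycle i m) σ : R) : ℍ[R, a, b])) := by
  classical
  have hne : ∀ {σ : Perm (Fin n)} {m y : Fin n}, ¬ σ.SameCycle i m → σ.SameCycle m y → y ≠ i := by
    rintro σ m y hm hy rfl
    exact hm hy.symm
  -- The involution attached to `m` reverses the cycle of `m` if `m` is its minimum and the cycle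
  -- avoids `i`, and does nothing otherwise. Reversal preserves orbits, hence also this condition.
  have key := sum_mul_prod_eq_sum_mul_prod_re (List.finRange n) (List.nodup_finRange n)
    (fun m (σ : Perm (Fin n)) =>
      if ¬ σ.SameCycle i m ∧ IsCycleMin σ m then σ.flipCycle m else σ)
    (by
      intro m σ
      by_cases hm : ¬ σ.SameCycle i m ∧ IsCycleMin σ m
      · simp only [if_pos hm, Perm.sameCycle_flipCycle, isCycleMin_flipCycle,
          Perm.flipCycle_flipCycle]
      · simp only [if_neg hm])
    (fun (σ : Perm (Fin n)) m => if ¬ σ.SameCycle i m ∧ IsCycleMin σ m then cycleProd A σ m else 1)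
    (by
      intro m σ
      by_cases hm : ¬ σ.SameCycle i m ∧ IsCycleMin σ m
      · simp only [if_pos hm, Perm.sameCycle_flipCycle, isCycleMin_flipCycle]
        exact cycleProd_flipCycle fun y hy => h _ _ (hne hm.1 hy)
          (hne hm.1 (Perm.sameCycle_apply_right.2 hy))
      · simp only [if_neg hm, star_one])
    (by
      intro m k σ hk
      by_cases hm : ¬ σ.SameCycle i m ∧ IsCycleMin σ m
      · simp only [if_pos hm, Perm.sameCycle_flipCycle, isCycleMin_flipCycle]
        by_cases hk' : ¬ σ.SameCycle i k ∧ IsCycleMin σ k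
        · simp only [if_pos hk']
          exact cycleProd_flipCycle_of_not_sameCycle fun e => hk (hk'.2.eq hm.2 e.symm)
        · simp only [if_neg hk']
      · simp only [if_neg hm])
    (by
      intro m σ
      by_cases hm : ¬ σ.SameCycle i m ∧ IsCycleMin σ m
      · simp only [if_pos hm]
        exact cycleProd_eq_coe_of_flipCycle_eq (fun y hy => h _ _ (hne hm.1 hy)
          (hne hm.1 (Perm.sameCycle_apply_right.2 hy))) (hd _ (hne hm.1 (Perm.SameCycle.refl ..)))
      · simp [if_neg hm])
    (fun σ => (Perm.sign σ : ℤ) • cycleProd A σ i)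
    (by
      intro m _ σ
      by_cases hm : ¬ σ.SameCycle i m ∧ IsCycleMin σ m
      · simp only [if_pos hm, Perm.sign_flipCycle]
        rw [cycleProd_flipCycle_of_not_sameCycle fun e => hm.1 e.symm]
      · simp only [if_neg hm])
  unfold rdet
  simp only [otherCycleMins_prod, ← smul_mul_assoc]
  rw [key]
  apply Finset.sum_congr rfl
  intro σ _
  congr 2
  rw [cyclesRe, Finset.prod_filter, Fin.prod_univ_def]
  congr 1
  apply List.map_congr_left
  intro m _
  split_ifs <;> simp

/-- The Moore determinant of a Hermitian quaternion matrix. -/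
noncomputable def mooreDet (A : Matrix (Fin n) (Fin n) ℍ[R, a, b]) : R :=
  ∑ σ : Perm (Fin n), (Perm.sign σ : ℤ) • cyclesRe A (fun _ => True) σ

/-- Hermitian matrices with scalar diagonal entries. -/
structure IsScalarHermitian (A : Matrix (Fin n) (Fin n) ℍ[R, a, b]) : Prop where
  star_apply : ∀ i j, star (A i j) = A j i
  diag : ∀ i, A i i = ((A i i).re : ℍ[R, a, b])

/-- For a fully Hermitian matrix the leading cycle, through `i`, can be reversed as well, and the
real part of its product does not depend on the starting point. -/
lemma IsScalarHermitian.rdet_eq {A : Matrix (Fin n) (Fin n) ℍ[R, a, b]} (hA : A.IsScalarHermitian)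
    (i : Fin n) : rdet i A = ((mooreDet A : R) : ℍ[R, a, b]) := by
  classical
  rw [rdet_eq_sum_mul_cyclesRe (fun _ _ _ _ => hA.star_apply _ _) (fun _ _ => hA.diag _)]
  have := sum_mul_eq_sum_mul_re (fun σ : Perm (Fin n) => σ.flipCycle i)
    (fun σ => Perm.flipCycle_flipCycle σ i)
    (fun σ => (((Perm.sign σ : ℤ) : R) : ℍ[R, a, b])) (fun σ => cycleProd A σ i)
    (fun σ => ((cyclesRe A (fun m => ¬ σ.SameCycle i m) σ : R) : ℍ[R, a, b]))
    (fun σ => by simp only [Perm.sign_flipCycle])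
    (fun σ => by
      simp only [Perm.sameCycle_flipCycle]
      rw [cyclesRe_flipCycle (fun _ => Iff.rfl) (fun _ => id)])
    (fun σ => cycleProd_flipCycle fun _ _ => hA.star_apply _ _)
    (fun σ => cycleProd_eq_coe_of_flipCycle_eq (fun _ _ => hA.star_apply _ _) (hA.diag _))
  have e : ∀ (σ : Perm (Fin n)) (x : ℍ[R, a, b]),
      (Perm.sign σ : ℤ) • x = (((Perm.sign σ : ℤ) : R) : ℍ[R, a, b]) * x := by
    intro σ x
    rw [zsmul_eq_mul, QuaternionAlgebra.coe_intCast]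
  simp only [e, ← mul_assoc]
  rw [this, mooreDet]
  simp only [zsmul_eq_mul]
  rw [← QuaternionAlgebra.coe_algebraMap, map_sum]
  apply Finset.sum_congr rfl
  intro σ _
  rw [cyclesRe_eq_mul A (k := i) (fun _ _ => trivial)]
  simp [mul_assoc, QuaternionAlgebra.coe_intCast]

end cycles

/-! ### Right multiplication by a transposition joins or splits cycles -/

section swap
variable {n : ℕ} {σ : Perm (Fin n)} {i k m : Fin n}

lemma sameCycle_mul_swap_of_not_sameCycle (h : ¬ σ.SameCycle i k) :
    (σ * Equiv.swap i k).SameCycle i k :=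
  Perm.sameCycle_of_pow_apply_eq (pow_mul_swap_apply_minimalPeriod h)

lemma sameCycle_mul_swap_of_sameCycle (h : ¬ σ.SameCycle i k) (hm : σ.SameCycle k m) :
    (σ * Equiv.swap i k).SameCycle i m := by
  obtain ⟨t, -, rfl⟩ := hm.exists_pow_eq'
  have hp := Perm.minimalPeriod_pos σ k
  rw [← Perm.iterate_eq_pow, ← Function.iterate_mod_minimalPeriod_eq, Perm.iterate_eq_pow]
  have hlt := Nat.mod_lt t hp
  generalize t % Function.minimalPeriod σ k = r at hlt
  cases r with
  | zero => exact sameCycle_mul_swap_of_not_sameCycle h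
  | succ r => exact Perm.sameCycle_of_pow_apply_eq (pow_mul_swap_apply h (by lia))

lemma not_sameCycle_mul_swap_iff (h : ¬ σ.SameCycle i k) :
    ¬ (σ * Equiv.swap i k).SameCycle i m ↔ ¬ σ.SameCycle i m ∧ ¬ σ.SameCycle k m := by
  have h' : ¬ σ.SameCycle k i := fun e => h e.symm
  constructor
  · refine fun hm => ⟨fun e => hm ?_, fun e => hm (sameCycle_mul_swap_of_sameCycle h e)⟩
    have := sameCycle_mul_swap_of_sameCycle h' e
    rw [Equiv.swap_comm] at this
    exact (sameCycle_mul_swap_of_not_sameCycle h).trans this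
  · rintro ⟨h1, h2⟩ e
    refine h1 (Perm.SameCycle.symm ((Perm.sameCycle_congr ?_ i).1 e.symm))
    intro y hy
    rw [Perm.mul_apply, Equiv.swap_apply_of_ne_of_ne]
    · rintro rfl; exact h1 hy.symm
    · rintro rfl; exact h2 hy.symm

lemma not_sameCycle_mul_swap_of_sameCycle (hik : i ≠ k) (h : σ.SameCycle i k) :
    ¬ (σ * Equiv.swap i k).SameCycle i k := by
  classical
  have hex : ∃ d : ℕ, (σ ^ d) k = i := by
    obtain ⟨d, -, hd⟩ := h.symm.exists_pow_eq'
    exact ⟨d, hd⟩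
  -- With `d` the first time the orbit of `k` reaches `i`, the new orbit of `i` follows that of `k`
  -- and closes up after `d` steps without meeting `k`.
  obtain ⟨d, hd, hmin⟩ : ∃ d : ℕ, (σ ^ d) k = i ∧ ∀ r < d, (σ ^ r) k ≠ i :=
    ⟨Nat.find hex, Nat.find_spec hex, fun r hr => Nat.find_min hex hr⟩
  have hd0 : 0 < d := by
    rcases Nat.eq_zero_or_pos d with rfl | h0
    · exact absurd hd.symm hik
    · exact h0
  have hk : ∀ r, 0 < r → r < d → (σ ^ r) k ≠ k := by
    intro r h0 hr e
    apply hmin (d - r) (by lia)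
    rw [← hd, ← congrArg (σ ^ (d - r)) e, ← Perm.mul_apply, ← pow_add, Nat.sub_add_cancel hr.le]
  have hpow : ∀ r < d, ((σ * Equiv.swap i k) ^ (r + 1)) i = (σ ^ (r + 1)) k := fun r hr =>
    pow_mul_swap_apply_of_forall_ne fun q h0 hq => ⟨hmin q (by lia), hk q h0 (by lia)⟩
  have hper : Function.IsPeriodicPt ⇑(σ * Equiv.swap i k) d i := by
    rw [Perm.isPeriodicPt_iff_pow]
    have := hpow (d - 1) (by lia)
    rwa [Nat.sub_add_cancel hd0, hd] at this
  intro e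
  obtain ⟨t, -, ht⟩ := e.exists_pow_eq'
  rw [← Perm.iterate_eq_pow, ← hper.iterate_mod_apply, Perm.iterate_eq_pow] at ht
  have hlt := Nat.mod_lt t hd0
  generalize t % d = r at hlt ht
  cases r with
  | zero => exact hik ht
  | succ r =>
    rw [hpow r (by lia)] at ht
    exact hk _ (Nat.succ_pos r) hlt ht

lemma sum_perm_eq_sum_mul_swap {M : Type*} [AddCommMonoid M] (hik : i ≠ k)
    [DecidablePred fun σ : Perm (Fin n) => σ.SameCycle i k] (f : Perm (Fin n) → M) :
    ∑ σ, f σ = ∑ σ with ¬ σ.SameCycle i k, (f σ + f (σ * Equiv.swap i k)) := by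
  rw [← Finset.sum_filter_not_add_sum_filter Finset.univ
    (fun σ : Perm (Fin n) => σ.SameCycle i k), Finset.sum_add_distrib]
  congr 1
  refine Finset.sum_nbij' (· * Equiv.swap i k) (· * Equiv.swap i k) ?_ ?_ ?_ ?_ ?_
  · intro σ hσ
    simp only [Finset.mem_filter, Finset.mem_univ, true_and] at hσ ⊢
    exact not_sameCycle_mul_swap_of_sameCycle hik hσ
  · intro σ hσ
    simp only [Finset.mem_filter, Finset.mem_univ, true_and] at hσ ⊢
    exact sameCycle_mul_swap_of_not_sameCycle hσ
  all_goals simp [mul_assoc]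

end swap

/-! ### Vanishing of the row determinant for a repeated row -/

section cofactor
variable {n : ℕ} {R : Type*} [CommRing R] {a b : R}

lemma IsScalarHermitian.rdet_updateRow_eq_zero {A : Matrix (Fin n) (Fin n) ℍ[R, a, b]}
    (hA : A.IsScalarHermitian) {i k : Fin n} (hik : i ≠ k) :
    rdet i (A.updateRow i (A k)) = 0 := by
  classical
  set B := A.updateRow i (A k) with hB
  have hBi : B i = B k := by
    rw [hB, updateRow_self, updateRow_ne hik.symm]
  have hBA : ∀ p, p ≠ i → B p = A p := fun p hp => updateRow_ne hp
  have hBs : ∀ p q, p ≠ i → q ≠ i → star (B p q) = B q p := fun p q hp hq => by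
    rw [hBA p hp, hBA q hq, hA.star_apply]
  have hBd : ∀ p, p ≠ i → B p p = ((B p p).re : ℍ[R, a, b]) := fun p hp => by
    rw [hBA p hp]; exact hA.diag p
  rw [rdet_eq_sum_mul_cyclesRe hBs hBd, sum_perm_eq_sum_mul_swap hik, Finset.sum_filter]
  -- Let `x` and `y` be the products along the cycles of `k` and `i`. Each pair contributes, up to
  -- sign and scalars, `re x * y - x * y`. Reversing the cycle of `k`, which avoids the altered row
  -- `i`, shows that these sum to zero. The summands are extended by 0 so that the involution acts
  -- on all permutations.
  have hsum := sum_mul_eq_sum_mul_re (fun σ : Perm (Fin n) => σ.flipCycle k)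
    (fun σ => Perm.flipCycle_flipCycle σ k)
    (fun σ => if ¬ σ.SameCycle i k then (((Perm.sign σ : ℤ) : R) : ℍ[R, a, b]) else 0)
    (fun σ => if ¬ σ.SameCycle i k then cycleProd B σ k else 0)
    (fun σ => if ¬ σ.SameCycle i k then cycleProd B σ i *
      ((cyclesRe B (fun m => ¬ σ.SameCycle i m ∧ ¬ σ.SameCycle k m) σ : R) : ℍ[R, a, b]) else 0)
    (fun σ => by simp only [Perm.sign_flipCycle, Perm.sameCycle_flipCycle])
    (fun σ => by
      simp only [Perm.sameCycle_flipCycle]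
      split_ifs with h
      · rfl
      · rw [cycleProd_flipCycle_of_not_sameCycle fun e => h e.symm,
          cyclesRe_flipCycle (fun _ => Iff.rfl) (fun _ hm => hm.2)])
    (fun σ => by
      simp only [Perm.sameCycle_flipCycle]
      split_ifs with h
      · simp
      · refine cycleProd_flipCycle fun y hy => hBs _ _ ?_ ?_
        · rintro rfl; exact h hy.symm
        · intro e; rw [← e] at h; exact h (Perm.sameCycle_apply_right.2 hy).symm)
    (fun σ hσ => by
      split_ifs with h
      · simp
      · refine cycleProd_eq_coe_of_flipCycle_eq (fun y hy => hBs _ _ ?_ ?_) (hBd _ hik.symm) hσ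
        · rintro rfl; exact h hy.symm
        · intro e; rw [← e] at h; exact h (Perm.sameCycle_apply_right.2 hy).symm)
  rw [← sub_eq_zero, ← Finset.sum_sub_distrib, ← neg_eq_zero, ← Finset.sum_neg_distrib] at hsum
  refine Eq.trans ?_ hsum
  apply Finset.sum_congr rfl
  intro σ _
  split_ifs with h
  · simp
  · rw [cycleProd_mul_swap h hBi, cyclesRe_eq_mul B (T := fun m => ¬ σ.SameCycle i m) (k := k)
        (fun m hm (e : σ.SameCycle i m) => h (e.trans hm.symm)),
      cyclesRe_congr (A := B) (B := B) (σ := σ)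
        (T := fun m => ¬ σ.SameCycle i m ∧ ¬ σ.SameCycle k m)
        (fun m => not_sameCycle_mul_swap_iff h) ?_ (fun _ _ _ _ => rfl), Perm.sign_mul,
      Perm.sign_swap hik]
    · have e : ∀ x : ℍ[R, a, b],
          (Perm.sign σ : ℤ) • x = (((Perm.sign σ : ℤ) : R) : ℍ[R, a, b]) * x := fun x => by
        rw [zsmul_eq_mul, QuaternionAlgebra.coe_intCast]
      simp only [mul_neg, mul_one, Units.val_neg, neg_smul, e, QuaternionAlgebra.coe_mul]
      rw [← mul_assoc (cycleProd B σ i), ← QuaternionAlgebra.coe_commutes (cycleProd B σ k).re]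
      noncomm_ring
    · rintro m ⟨h1, h2⟩ y hy
      rw [Perm.mul_apply, Equiv.swap_apply_of_ne_of_ne]
      · rintro rfl; exact h1 hy.symm
      · rintro rfl; exact h2 hy.symm

end cofactor

/-! ### Row expansion and the passage from column to row determinants -/

section rowDet
variable {n : ℕ} {S : Type*} [Ring S]

lemma cycleProd_eq_mul_of_updateRow (A : Matrix (Fin n) (Fin n) S) (i : Fin n)
    (σ : Perm (Fin n)) : ∃ u : S, ∀ v : Fin n → S, cycleProd (A.updateRow i v) σ i = v (σ i) * u := by
  have hp := Perm.minimalPeriod_pos σ i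
  refine ⟨walkProd A σ (σ i) (Function.minimalPeriod σ i - 1), fun v => ?_⟩
  rw [cycleProd_eq_walkProd, ← Nat.sub_add_cancel hp, walkProd_succ', updateRow_self,
    Nat.sub_add_cancel hp]
  congr 1
  apply walkProd_congr
  intro s hs
  rw [updateRow_ne]
  rw [← Perm.mul_apply, ← pow_succ]
  intro e
  have := ((Perm.isPeriodicPt_iff_pow σ (s + 1) i).2 e).minimalPeriod_le (Nat.succ_pos s)
  lia

/-- The `i`-th row determinant is left linear in the `i`-th row. -/
lemma rdet_updateRow_eq_sum (A : Matrix (Fin n) (Fin n) S) (i : Fin n) (v : Fin n → S) :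
    rdet i (A.updateRow i v) = ∑ j, v j * rdet i (A.updateRow i (Pi.single j 1)) := by
  have hother : ∀ (σ : Perm (Fin n)) (v : Fin n → S),
      (otherCycleMins σ i).map (cycleProd (A.updateRow i v) σ) =
        (otherCycleMins σ i).map (cycleProd A σ) := by
    intro σ v
    apply List.map_congr_left
    intro m hm
    simp only [otherCycleMins, Finset.mem_sort, Finset.mem_filter] at hm
    refine cycleProd_congr (fun _ _ => rfl) fun y hy => ?_
    rw [updateRow_ne]
    rintro rfl
    exact hm.2.1 hy.symm
  simp only [rdet, hother, Finset.mul_sum]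
  rw [Finset.sum_comm]
  apply Finset.sum_congr rfl
  intro σ _
  obtain ⟨u, hu⟩ := cycleProd_eq_mul_of_updateRow A i σ
  simp only [hu]
  rw [Finset.sum_eq_single (σ i)]
  · rw [Pi.single_eq_same, one_mul, mul_smul_comm, mul_assoc]
  · intro j _ hj
    rw [Pi.single_eq_of_ne hj.symm]
    simp
  · simp

/-- Conjugation reverses the order of the factors, both among and inside the cycles; substituting
`σ⁻¹` restores the direction of travel. -/
lemma cdet_eq_star_rdet [StarRing S] (j : Fin n) (A : Matrix (Fin n) (Fin n) S) :
    cdet j A = star (rdet j Aᴴ) := by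
  rw [rdet, star_sum, cdet, ← Equiv.sum_comp (Equiv.inv (Perm (Fin n)))]
  apply Finset.sum_congr rfl
  intro σ _
  have hmin : otherCycleMins σ⁻¹ j = otherCycleMins σ j := by
    simp only [otherCycleMins, Perm.sameCycle_inv]
  have hc : ∀ x, cycleProd A σ⁻¹ x = star (cycleProd Aᴴ σ x) := fun x => by
    rw [← cycleProd_conjTranspose_inv, conjTranspose_conjTranspose]
  rw [Equiv.inv_apply, hmin, Perm.sign_inv, star_zsmul, star_mul, hc]
  congr 2
  induction otherCycleMins σ j with
  | nil => simp
  | cons m L ih =>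
    rw [List.reverse_cons, List.map_append, List.prod_append, ih]
    simp [hc]

/-- The transposed matrix of the row cofactors. -/
noncomputable def rowAdjugate (A : Matrix (Fin n) (Fin n) S) : Matrix (Fin n) (Fin n) S :=
  of fun j i => rdet i (A.updateRow i (Pi.single j 1))

lemma rdet_updateRow_eq_dotProduct (A : Matrix (Fin n) (Fin n) S) (i : Fin n) (v : Fin n → S) :
    rdet i (A.updateRow i v) = ∑ j, v j * rowAdjugate A j i :=
  rdet_updateRow_eq_sum A i v

end rowDet

/-! ### The adjugate identity -/

section adjugate
variable {n : ℕ} {R : Type*} [CommRing R] {a b : R}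

lemma IsScalarHermitian.mul_rowAdjugate {A : Matrix (Fin n) (Fin n) ℍ[R, a, b]}
    (hA : A.IsScalarHermitian) :
    A * rowAdjugate A = scalar (Fin n) ((mooreDet A : R) : ℍ[R, a, b]) := by
  ext1 k i
  rw [mul_apply, ← rdet_updateRow_eq_dotProduct]
  by_cases h : k = i
  · subst h
    rw [updateRow_eq_self, hA.rdet_eq]
    simp
  · rw [hA.rdet_updateRow_eq_zero (Ne.symm h)]
    simp [h]

end adjugate

/-! ### The norm given by the regular representation -/

section norm
variable {n : ℕ} {R : Type*} [CommRing R] {a b : R}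

/-- The regular representation of quaternion matrices by matrices over the base ring. -/
noncomputable def regularRep :
    Matrix (Fin n) (Fin n) ℍ[R, a, b] →+* Matrix (Fin n × Fin 4) (Fin n × Fin 4) R :=
  (compRingEquiv (Fin n) (Fin 4) R).toRingHom.comp
    (Algebra.leftMulMatrix (QuaternionAlgebra.basisOneIJK a 0 b)).toRingHom.mapMatrix

lemma regularRep_apply (A : Matrix (Fin n) (Fin n) ℍ[R, a, b]) (p q : Fin n × Fin 4) :
    regularRep A p q =
      Algebra.leftMulMatrix (QuaternionAlgebra.basisOneIJK a 0 b) (A p.1 q.1) p.2 q.2 := rfl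

/-- The determinant of the regular representation. -/
noncomputable def regularNorm : Matrix (Fin n) (Fin n) ℍ[R, a, b] →* R :=
  detMonoidHom.comp (regularRep (n := n) (a := a) (b := b)).toMonoidHom

lemma leftMulMatrix_coe (d : R) : Algebra.leftMulMatrix (QuaternionAlgebra.basisOneIJK a 0 b)
    (d : ℍ[R, a, b]) = d • 1 := by
  rw [← QuaternionAlgebra.coe_algebraMap, AlgHom.commutes, Algebra.algebraMap_eq_smul_one]

/-- The matrix is block triangular with identity blocks except for one scalar block of size 4, the
rank of the quaternion algebra. -/
lemma det_eq_pow_of_blocks {M : Matrix (Fin n × Fin 4) (Fin n × Fin 4) R} {k : Fin n} {d : R}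
    (h0 : ∀ p, p.1 ≠ k → ∀ q, M p q = (1 : Matrix _ _ R) p q)
    (h1 : ∀ p q, p.1 = k → q.1 = k → M p q = d * (1 : Matrix _ _ R) p q) : M.det = d ^ 4 := by
  rw [twoBlockTriangular_det M (fun p => p.1 = k)]
  · have e1 : M.toSquareBlockProp (fun p => p.1 = k) = d • 1 := by
      ext p q
      rw [toSquareBlockProp_def, of_apply, h1 _ _ p.2 q.2, smul_apply, smul_eq_mul, one_apply,
        one_apply]
      simp only [Subtype.ext_iff]
    have e2 : M.toSquareBlockProp (fun p => ¬ p.1 = k) = 1 := by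
      ext p q
      rw [toSquareBlockProp_def, of_apply, h0 _ p.2, one_apply, one_apply]
      simp only [Subtype.ext_iff]
    have hc : Fintype.card { p : Fin n × Fin 4 // p.1 = k } = 4 := by
      rw [Fintype.card_congr (β := Fin 4) ⟨fun p => p.1.2, fun s => ⟨(k, s), rfl⟩, ?_, ?_⟩]
      · simp
      · rintro ⟨⟨p, s⟩, rfl⟩; rfl
      · intro s; rfl
    rw [e1, e2, det_one, mul_one, det_smul, det_one, mul_one, hc]
  · intro p hp q hq
    rw [h0 p hp, one_apply_ne]
    rintro rfl
    exact hp hq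

lemma regularRep_apply_of_eq_one {A : Matrix (Fin n) (Fin n) ℍ[R, a, b]} {p q : Fin n × Fin 4}
    (h : A p.1 q.1 = (1 : Matrix (Fin n) (Fin n) ℍ[R, a, b]) p.1 q.1) :
    regularRep A p q = (1 : Matrix _ _ R) p q := by
  rw [← map_one (regularRep (n := n) (a := a) (b := b)), regularRep_apply, regularRep_apply, h]

lemma regularRep_apply_of_eq_coe {A : Matrix (Fin n) (Fin n) ℍ[R, a, b]} {p q : Fin n × Fin 4}
    {d : R} (hpq : p.1 = q.1) (h : A p.1 q.1 = (d : ℍ[R, a, b])) :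
    regularRep A p q = d * (1 : Matrix _ _ R) p q := by
  rw [regularRep_apply, h, leftMulMatrix_coe, smul_apply, smul_eq_mul, one_apply, one_apply]
  simp only [Prod.ext_iff, hpq, true_and]

lemma regularNorm_updateRow_one {k : Fin n} {v : Fin n → ℍ[R, a, b]} {d : R}
    (hv : v k = (d : ℍ[R, a, b])) :
    regularNorm ((1 : Matrix (Fin n) (Fin n) ℍ[R, a, b]).updateRow k v) = d ^ 4 := by
  refine det_eq_pow_of_blocks (k := k) (fun p hp q => ?_) (fun p q hp hq => ?_)
  · exact regularRep_apply_of_eq_one (by rw [updateRow_ne hp])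
  · exact regularRep_apply_of_eq_coe (hp.trans hq.symm) (by rw [hp, hq, updateRow_self, hv])

lemma regularNorm_updateCol_one {k : Fin n} {v : Fin n → ℍ[R, a, b]} {d : R}
    (hv : v k = (d : ℍ[R, a, b])) :
    regularNorm ((1 : Matrix (Fin n) (Fin n) ℍ[R, a, b]).updateCol k v) = d ^ 4 := by
  change (regularRep _).det = _
  rw [← det_transpose]
  refine det_eq_pow_of_blocks (k := k) (fun p hp q => ?_) (fun p q hp hq => ?_)
  · rw [transpose_apply, regularRep_apply_of_eq_one (by rw [updateCol_ne hp]), one_apply, one_apply]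
    simp only [eq_comm]
  · rw [transpose_apply, regularRep_apply_of_eq_coe (d := d) (hq.trans hp.symm)
      (by rw [hp, hq, updateCol_self, hv]), one_apply, one_apply]
    simp only [eq_comm]

end norm

/-! ### The norm of a Hermitian matrix as the fourth power of its Moore determinant -/

section clear
variable {n : ℕ} {R : Type*} [CommRing R] {a b : R}

/-- The rows and columns with index in `s` replaced by those of the identity matrix. -/
def clear {S : Type*} [Zero S] [One S] (s : Finset (Fin n)) (A : Matrix (Fin n) (Fin n) S) :
    Matrix (Fin n) (Fin n) S :=
  of fun i j => if i ∈ s ∨ j ∈ s then (1 : Matrix (Fin n) (Fin n) S) i j else A i j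

lemma clear_apply {S : Type*} [Zero S] [One S] (s : Finset (Fin n))
    (A : Matrix (Fin n) (Fin n) S) (i j : Fin n) :
    clear s A i j = if i ∈ s ∨ j ∈ s then (1 : Matrix (Fin n) (Fin n) S) i j else A i j := rfl

lemma clear_empty {S : Type*} [Zero S] [One S] (A : Matrix (Fin n) (Fin n) S) :
    clear ∅ A = A := by
  ext i j; simp [clear_apply]

lemma clear_univ {S : Type*} [Zero S] [One S] (A : Matrix (Fin n) (Fin n) S) :
    clear Finset.univ A = 1 := by
  ext i j; simp [clear_apply]

lemma clear_one {S : Type*} [Zero S] [One S] (s : Finset (Fin n)) :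
    clear s (1 : Matrix (Fin n) (Fin n) S) = 1 := by
  ext i j; simp [clear_apply]

lemma clear_singleton_clear {S : Type*} [Zero S] [One S] (k : Fin n) (s : Finset (Fin n))
    (A : Matrix (Fin n) (Fin n) S) : clear {k} (clear s A) = clear (insert k s) A := by
  ext i j
  simp only [clear_apply, Finset.mem_singleton, Finset.mem_insert]
  split_ifs <;> first | rfl | tauto

lemma clear_map {S T : Type*} [Ring S] [Ring T] (f : S →+* T) (s : Finset (Fin n))
    (A : Matrix (Fin n) (Fin n) S) : clear s (A.map f) = (clear s A).map f := by
  ext i j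
  simp only [clear_apply, map_apply, one_apply]
  split_ifs <;> simp

lemma isScalarHermitian_one : (1 : Matrix (Fin n) (Fin n) ℍ[R, a, b]).IsScalarHermitian where
  star_apply i j := by
    simp only [one_apply, eq_comm (a := j)]
    split_ifs <;> simp
  diag i := by simp

lemma IsScalarHermitian.clear {A : Matrix (Fin n) (Fin n) ℍ[R, a, b]} (hA : A.IsScalarHermitian)
    (s : Finset (Fin n)) : (clear s A).IsScalarHermitian where
  star_apply i j := by
    simp only [clear_apply, or_comm (a := j ∈ s)]
    split_ifs
    · exact isScalarHermitian_one.star_apply i j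
    · exact hA.star_apply i j
  diag i := by
    simp only [clear_apply]
    split_ifs
    · exact isScalarHermitian_one.diag i
    · exact hA.diag i

/-- Only permutations fixing `k` contribute, and for these column `k` is not met outside the
diagonal, so it may be cleared too. This presents the cofactor as a row determinant of a Hermitian
matrix when `A` is Hermitian. -/
lemma rowAdjugate_apply_self {S : Type*} [Ring S] (A : Matrix (Fin n) (Fin n) S) (k : Fin n) :
    rowAdjugate A k k = rdet k (clear {k} A) := by
  have hrow : (clear {k} A).updateRow k (Pi.single k 1) = clear {k} A := by
    ext i j
    by_cases h : i = k
    · subst h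
      rw [updateRow_self]
      simp [clear_apply, one_apply, Pi.single_apply, eq_comm]
    · rw [updateRow_ne h]
  rw [rowAdjugate, of_apply, ← hrow]
  apply Finset.sum_congr rfl
  intro σ _
  congr 1
  by_cases hσ : σ k = k
  · congr 1
    · refine cycleProd_congr (fun _ _ => rfl) fun y hy => ?_
      obtain ⟨t, -, rfl⟩ := hy.exists_pow_eq'
      rw [Perm.pow_apply_eq_self_of_apply_eq_self hσ, updateRow_self, updateRow_self]
    · congr 1
      apply List.map_congr_left
      intro m hm
      simp only [otherCycleMins, Finset.mem_sort, Finset.mem_filter] at hm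
      refine cycleProd_congr (fun _ _ => rfl) fun y hy => ?_
      have h1 : y ≠ k := by rintro rfl; exact hm.2.1 hy.symm
      have h2 : σ y ≠ k := by
        intro e
        rw [← e] at hm
        exact hm.2.1 (Perm.sameCycle_apply_right.2 hy).symm
      rw [updateRow_ne h1, updateRow_ne h1, clear_apply, if_neg (by simp [h1, h2])]
  · obtain ⟨u, hu⟩ := cycleProd_eq_mul_of_updateRow A k σ
    obtain ⟨v, hv⟩ := cycleProd_eq_mul_of_updateRow (clear {k} A) k σ
    rw [hu, hv, Pi.single_eq_of_ne hσ]
    simp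

/-- Multiply `A` by the identity matrix with column `k` taken from the adjugate: column `k` of `A`
becomes `mooreDet A` times a unit vector. The result also factors as the cleared matrix times an
identity matrix with modified row `k`. Taking norms gives the relation. -/
lemma IsScalarHermitian.regularNorm_mul_pow {A : Matrix (Fin n) (Fin n) ℍ[R, a, b]}
    (hA : A.IsScalarHermitian) (k : Fin n) :
    regularNorm A * mooreDet (Matrix.clear {k} A) ^ 4 =
      regularNorm (Matrix.clear {k} A) * mooreDet A ^ 4 := by
  rw [← regularNorm_updateCol_one (k := k) (v := fun i => rowAdjugate A i k)
      (by rw [rowAdjugate_apply_self, (hA.clear {k}).rdet_eq]),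
    ← regularNorm_updateRow_one (k := k)
      (v := fun j => if j = k then ((mooreDet A : R) : ℍ[R, a, b]) else A k j) (if_pos rfl),
    ← map_mul, ← map_mul]
  congr 1
  ext1 i j
  have hadj := congrFun (congrFun hA.mul_rowAdjugate i) k
  rw [mul_apply] at hadj
  have hR : ∀ l, l ≠ k → (1 : Matrix (Fin n) (Fin n) ℍ[R, a, b]).updateRow k
      (fun j => if j = k then ((mooreDet A : R) : ℍ[R, a, b]) else A k j) l j =
        (1 : Matrix (Fin n) (Fin n) ℍ[R, a, b]) l j := fun l hl => by rw [updateRow_ne hl]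
  have hleft : (A * (1 : Matrix (Fin n) (Fin n) ℍ[R, a, b]).updateCol k
      fun i => rowAdjugate A i k) i j =
      if j = k then scalar (Fin n) ((mooreDet A : R) : ℍ[R, a, b]) i k else A i j := by
    rw [mul_apply]
    split_ifs with hj
    · subst hj
      simp only [updateCol_self]
      exact hadj
    · simp only [updateCol_ne hj]
      rw [← mul_apply, mul_one]
  rw [hleft, mul_apply]
  by_cases hi : i = k
  · subst hi
    rw [Finset.sum_eq_single i]
    · have e : Matrix.clear {i} A i i = 1 := by simp [clear_apply]
      rw [updateRow_self, e, one_mul]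
      by_cases hj : j = i <;> simp [hj]
    · intro l _ hl
      rw [clear_apply, if_pos (by simp), one_apply_ne hl.symm, zero_mul]
    · simp
  · rw [Finset.sum_eq_single j]
    · by_cases hj : j = k
      · subst hj
        rw [clear_apply, if_pos (by simp), one_apply_ne hi]
        simp [hi]
      · have e : Matrix.clear {k} A i j = A i j := by simp [clear_apply, hi, hj]
        rw [hR j hj, e, if_neg hj, one_apply_eq, mul_one]
    · intro l _ hl
      by_cases hlk : l = k
      · subst hlk
        rw [clear_apply, if_pos (by simp), one_apply_ne hi, zero_mul]
      · rw [hR l hlk, one_apply_ne hl, mul_zero]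
    · simp

lemma mooreDet_one : mooreDet (1 : Matrix (Fin n) (Fin n) ℍ[R, a, b]) = 1 := by
  have hc : ∀ (σ : Perm (Fin n)) (m : Fin n), σ m ≠ m →
      cycleProd (1 : Matrix (Fin n) (Fin n) ℍ[R, a, b]) σ m = 0 := by
    intro σ m hm
    obtain ⟨u, hu⟩ := cycleProd_eq_mul_of_updateRow (1 : Matrix (Fin n) (Fin n) ℍ[R, a, b]) m σ
    have := hu ((1 : Matrix (Fin n) (Fin n) ℍ[R, a, b]) m)
    rwa [updateRow_eq_self, one_apply_ne hm.symm, zero_mul] at this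
  rw [mooreDet, Finset.sum_eq_single 1]
  · rw [Perm.sign_one, Units.val_one, one_smul, cyclesRe]
    apply Finset.prod_eq_one
    intro m _
    have : Function.minimalPeriod ⇑(1 : Perm (Fin n)) m = 1 :=
      Function.minimalPeriod_eq_one_iff_isFixedPt.2 rfl
    rw [cycleProd_eq_walkProd, this, walkProd_succ', Perm.one_apply, one_apply_eq]
    simp
  · intro σ _ hσ
    obtain ⟨k, hk⟩ : ∃ k, σ k ≠ k := by
      by_contra! h
      exact hσ (Equiv.ext h)
    rw [cyclesRe_eq_mul _ (k := k) (fun _ _ => trivial), hc σ k hk]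
    simp
  · simp

/-- Starting from the identity, indices are uncleared one at a time;
`IsScalarHermitian.regularNorm_mul_pow` carries the formula along, after cancelling the nonzero
minor already reached. -/
lemma IsScalarHermitian.regularNorm_eq_pow [IsDomain R] {A : Matrix (Fin n) (Fin n) ℍ[R, a, b]}
    (hA : A.IsScalarHermitian) (h0 : ∀ s, mooreDet (Matrix.clear s A) ≠ 0) :
    regularNorm A = mooreDet A ^ 4 := by
  have key : ∀ s : Finset (Fin n),
      regularNorm (Matrix.clear sᶜ A) = mooreDet (Matrix.clear sᶜ A) ^ 4 := by
    intro s
    induction s using Finset.induction_on with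
    | empty => rw [Finset.compl_empty, clear_univ, mooreDet_one, map_one, one_pow]
    | insert k s hk ih =>
      have h := (hA.clear (insert k s)ᶜ).regularNorm_mul_pow k
      have e : insert k (insert k s)ᶜ = sᶜ := by
        ext l
        simp only [Finset.mem_insert, Finset.mem_compl]
        by_cases hl : l = k <;> simp [hl, hk]
      rw [clear_singleton_clear, e, ih, mul_comm] at h
      exact mul_left_cancel₀ (pow_ne_zero 4 (h0 _)) h
  simpa [clear_empty] using key Finset.univ

end clear

/-! ### Extension of scalars -/

section map
variable {n : ℕ} {R T : Type*} [CommRing R] [CommRing T] {a b : R} {c d : T}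

/-- Extension of scalars for quaternion algebras. -/
def quaternionMap (f : R →+* T) (ha : f a = c) (hb : f b = d) : ℍ[R, a, b] →+* ℍ[T, c, d] where
  toFun x := ⟨f x.re, f x.imI, f x.imJ, f x.imK⟩
  map_one' := by ext <;> simp
  map_zero' := by ext <;> simp
  map_add' x y := by ext <;> simp
  map_mul' x y := by subst ha hb; ext <;> simp

variable (f : R →+* T) (ha : f a = c) (hb : f b = d)

lemma re_quaternionMap (x : ℍ[R, a, b]) : (quaternionMap f ha hb x).re = f x.re := rfl

lemma quaternionMap_coe (r : R) :
    quaternionMap f ha hb (r : ℍ[R, a, b]) = ((f r : T) : ℍ[T, c, d]) := by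
  ext <;> simp [quaternionMap]

lemma quaternionMap_star (x : ℍ[R, a, b]) :
    quaternionMap f ha hb (star x) = star (quaternionMap f ha hb x) := by
  ext <;> simp [quaternionMap]

lemma quaternionMap_smul (r : R) (x : ℍ[R, a, b]) :
    quaternionMap f ha hb (r • x) = f r • quaternionMap f ha hb x := by
  ext <;> simp [quaternionMap]

lemma mooreDet_map (A : Matrix (Fin n) (Fin n) ℍ[R, a, b]) :
    mooreDet (A.map (quaternionMap f ha hb)) = f (mooreDet A) := by
  simp only [mooreDet, map_sum, map_zsmul, cyclesRe, map_prod, map_cycleProd, re_quaternionMap]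

lemma IsScalarHermitian.map {A : Matrix (Fin n) (Fin n) ℍ[R, a, b]} (hA : A.IsScalarHermitian) :
    (A.map (quaternionMap f ha hb)).IsScalarHermitian where
  star_apply i j := by rw [map_apply, map_apply, ← quaternionMap_star, hA.star_apply]
  diag i := by
    rw [map_apply, hA.diag, quaternionMap_coe]
    simp

end map

/-! ### Deformation to the identity and similarity invariance -/

section pencil
open Polynomial
variable {n : ℕ} {F : Type*} [Field F] {a b : F}

/-- The embedding of a quaternion algebra into its polynomial extension. -/
noncomputable def quaternionC : ℍ[F, a, b] →+* ℍ[F[X], C a, C b] := quaternionMap C rfl rfl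

/-- Evaluation at `t` of quaternions with polynomial coefficients. -/
noncomputable def quaternionEval (t : F) : ℍ[F[X], C a, C b] →+* ℍ[F, a, b] :=
  quaternionMap (evalRingHom t) (by simp) (by simp)

/-- The line of matrices through `A` (at `0`) and the identity matrix (at `1`). -/
noncomputable def pencil (A : Matrix (Fin n) (Fin n) ℍ[F, a, b]) :
    Matrix (Fin n) (Fin n) ℍ[F[X], C a, C b] :=
  (X : F[X]) • (1 : Matrix (Fin n) (Fin n) ℍ[F[X], C a, C b]) +
    (1 - X : F[X]) • A.map quaternionC

lemma quaternionEval_quaternionC (t : F) (x : ℍ[F, a, b]) :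
    quaternionEval t (quaternionC x) = x := by
  ext <;> simp [quaternionEval, quaternionC, quaternionMap]

lemma pencil_map_eval (A : Matrix (Fin n) (Fin n) ℍ[F, a, b]) (t : F) :
    (pencil A).map (quaternionEval t) = t • 1 + (1 - t) • A := by
  ext1 i j
  simp only [pencil, map_apply, add_apply, smul_apply, map_add, one_apply]
  rw [quaternionEval, quaternionMap_smul, quaternionMap_smul, ← quaternionEval,
    quaternionEval_quaternionC]
  congr 2
  · simp
  · split_ifs <;> simp
  · simp

lemma IsScalarHermitian.smul_add_smul {R : Type*} [CommRing R] {a b : R}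
    {A B : Matrix (Fin n) (Fin n) ℍ[R, a, b]} (hA : A.IsScalarHermitian)
    (hB : B.IsScalarHermitian) (r s : R) : (r • A + s • B).IsScalarHermitian where
  star_apply i j := by
    simp only [add_apply, smul_apply]
    rw [← hA.star_apply, ← hB.star_apply]
    ext <;> simp
  diag i := by
    simp only [add_apply, smul_apply]
    rw [hA.diag, hB.diag]
    ext <;> simp

lemma IsScalarHermitian.pencil {A : Matrix (Fin n) (Fin n) ℍ[F, a, b]}
    (hA : A.IsScalarHermitian) : (pencil A).IsScalarHermitian :=
  isScalarHermitian_one.smul_add_smul (hA.map C rfl rfl) _ _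

lemma eval_mooreDet_clear_pencil (A : Matrix (Fin n) (Fin n) ℍ[F, a, b]) (s : Finset (Fin n))
    (t : F) : (mooreDet (clear s (pencil A))).eval t =
      mooreDet (clear s (t • 1 + (1 - t) • A)) := by
  rw [← pencil_map_eval, clear_map, quaternionEval, mooreDet_map]
  rfl

lemma eval_mooreDet_pencil (A : Matrix (Fin n) (Fin n) ℍ[F, a, b]) (t : F) :
    (mooreDet (pencil A)).eval t = mooreDet (t • 1 + (1 - t) • A) := by
  simpa only [clear_empty] using eval_mooreDet_clear_pencil A ∅ t

/-- At `t = 1` the pencil and all its cleared forms are the identity, so the Moore determinants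
involved are nonzero polynomials, whatever minors of `A` vanish. -/
lemma IsScalarHermitian.regularNorm_pencil {A : Matrix (Fin n) (Fin n) ℍ[F, a, b]}
    (hA : A.IsScalarHermitian) :
    regularNorm (Matrix.pencil A) = mooreDet (Matrix.pencil A) ^ 4 := by
  refine hA.pencil.regularNorm_eq_pow fun s h => ?_
  have := eval_mooreDet_clear_pencil A s 1
  rw [h, one_smul, sub_self, zero_smul, add_zero, clear_one, mooreDet_one, eval_zero] at this
  exact zero_ne_one this

/-- Since `F[X]` is integrally closed, `p` and `q` divide each other. They differ by a constant,
which the common value 1 fixes. -/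
lemma eq_of_pow_eq_pow_of_eval_eq_one {p q : F[X]} {m : ℕ} (hm : m ≠ 0) (h : p ^ m = q ^ m)
    {t : F} (hp : p.eval t = 1) (hq : q.eval t = 1) : p = q := by
  have hpq : Associated p q := associated_of_dvd_dvd ((IsIntegrallyClosed.pow_dvd_pow_iff hm).1 h.dvd)
    ((IsIntegrallyClosed.pow_dvd_pow_iff hm).1 h.symm.dvd)
  obtain ⟨u, rfl⟩ := hpq
  obtain ⟨c, -, hc⟩ := Polynomial.isUnit_iff.1 u.isUnit
  rw [← hc] at hq ⊢
  rw [eval_mul, hp, eval_C, one_mul] at hq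
  rw [hq, C_1, mul_one]

/-- Moore determinants are invariant under similarity. -/
lemma IsScalarHermitian.mooreDet_eq_of_similar {A B P Q : Matrix (Fin n) (Fin n) ℍ[F, a, b]}
    (hA : A.IsScalarHermitian) (hB : B.IsScalarHermitian) (h : A * P = P * B) (hPQ : P * Q = 1) :
    mooreDet A = mooreDet B := by
  -- The similarity extends to the pencils because the identity matrix and the polynomial
  -- coefficients commute with `P`.
  have hmul : Matrix.pencil A * P.map quaternionC = P.map quaternionC * Matrix.pencil B := by
    simp only [Matrix.pencil, add_mul, mul_add, smul_mul_assoc, mul_smul_comm, one_mul, mul_one]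
    rw [← Matrix.map_mul, ← Matrix.map_mul, h]
  have hunit : regularNorm (P.map quaternionC) * regularNorm (Q.map quaternionC) = 1 := by
    rw [← map_mul, ← Matrix.map_mul, hPQ, Matrix.map_one _ (map_zero _) (map_one _), map_one]
  have hN := congrArg regularNorm hmul
  rw [map_mul, map_mul, mul_comm, hA.regularNorm_pencil, hB.regularNorm_pencil] at hN
  have hpow := mul_left_cancel₀ (left_ne_zero_of_mul_eq_one hunit) hN
  have hpq := eq_of_pow_eq_pow_of_eval_eq_one (t := 1) (by norm_num) hpow
    (by rw [eval_mooreDet_pencil]; simp [mooreDet_one])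
    (by rw [eval_mooreDet_pencil]; simp [mooreDet_one])
  have := congrArg (eval 0) hpq
  simpa [eval_mooreDet_pencil] using this

end pencil

/-! ### Double cofactors as matrix entries -/

section doubleCofactor
variable {n : ℕ} {R : Type*} [CommRing R] {a b : R}

lemma isScalarHermitian_mul_conjTranspose (A : Matrix (Fin n) (Fin n) ℍ[R, a, b]) :
    (A * Aᴴ).IsScalarHermitian where
  star_apply i j := by
    rw [← conjTranspose_apply, conjTranspose_mul, conjTranspose_conjTranspose]
  diag i := by
    rw [mul_apply, ← QuaternionAlgebra.coe_algebraMap]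
    have : ∀ j, A i j * Aᴴ j i =
        algebraMap R ℍ[R, a, b] (A i j * Aᴴ j i).re := fun j =>
      quaternion_mul_star_eq_coe (A i j)
    rw [Finset.sum_congr rfl fun j _ => this j, ← map_sum]
    rfl

lemma rightDoubleCofactor_eq (A : Matrix (Fin n) (Fin n) ℍ[R, a, b]) (i j : Fin n) :
    rightDoubleCofactor A i j = (Aᴴ * rowAdjugate (A * Aᴴ)) j i := by
  rw [rightDoubleCofactor, rdet_updateRow_eq_dotProduct, mul_apply]

lemma leftDoubleCofactor_eq (A : Matrix (Fin n) (Fin n) ℍ[R, a, b]) (i j : Fin n) :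
    leftDoubleCofactor A i j = ((rowAdjugate (Aᴴ * A))ᴴ * Aᴴ) j i := by
  have h : ((Aᴴ * A).updateCol j fun k => Aᴴ k i)ᴴ = (Aᴴ * A).updateRow j (A i) := by
    rw [← updateRow_conjTranspose, conjTranspose_mul, conjTranspose_conjTranspose]
    congr 1
    ext1 k
    simp
  rw [leftDoubleCofactor, cdet_eq_star_rdet, h, rdet_updateRow_eq_dotProduct, ← conjTranspose_mul,
    conjTranspose_apply, mul_apply]

end doubleCofactor

end Matrix

theorem mainTheorem7 {F : Type*} [Field F] (a b : F) (n : ℕ) [NeZero n]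
    (A : Matrix (Fin n) (Fin n) ℍ[F, a, b]) (hA : Matrix.ddet A ≠ 0) :
    ∀ i j : Fin n, Matrix.leftDoubleCofactor A i j = Matrix.rightDoubleCofactor A i j := by
  have hH := Matrix.isScalarHermitian_mul_conjTranspose A
  have hK : (Aᴴ * A).IsScalarHermitian := by
    simpa using Matrix.isScalarHermitian_mul_conjTranspose Aᴴ
  have hd : Matrix.mooreDet (A * Aᴴ) ≠ 0 := by
    intro h
    apply hA
    rw [Matrix.ddet, Matrix.hermitianDet, hH.rdet_eq, h, QuaternionAlgebra.coe_zero]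
  have scalar_eq : ∀ d : F, Matrix.scalar (Fin n) (d : ℍ[F, a, b]) =
      d • (1 : Matrix (Fin n) (Fin n) ℍ[F, a, b]) := by
    intro d
    ext1 i j
    by_cases h : i = j
    · subst h
      ext <;> simp
    · simp [h]
  have h1 := hH.mul_rowAdjugate
  have h2 := hK.mul_rowAdjugate
  rw [scalar_eq] at h1 h2
  have hinv : A * ((Matrix.mooreDet (A * Aᴴ))⁻¹ • (Aᴴ * Matrix.rowAdjugate (A * Aᴴ))) = 1 := by
    rw [mul_smul_comm, ← mul_assoc, h1, smul_smul, inv_mul_cancel₀ hd, one_smul]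
  -- The intertwining relation is associativity, `(A * Aᴴ) * A = A * (Aᴴ * A)`.
  have hdet : Matrix.mooreDet (A * Aᴴ) = Matrix.mooreDet (Aᴴ * A) :=
    hH.mooreDet_eq_of_similar hK (mul_assoc A Aᴴ A) hinv
  rw [← hdet] at h2
  have h3 : (Matrix.rowAdjugate (Aᴴ * A))ᴴ * (Aᴴ * A) =
      Matrix.mooreDet (A * Aᴴ) • (1 : Matrix (Fin n) (Fin n) ℍ[F, a, b]) := by
    have := congrArg Matrix.conjTranspose h2
    rw [Matrix.conjTranspose_mul, Matrix.conjTranspose_mul, Matrix.conjTranspose_conjTranspose]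
      at this
    rw [this, ← scalar_eq]
    ext1 i j
    by_cases h : i = j
    · subst h
      ext <;> simp
    · simp [h, Ne.symm h]
  have h4 : (Matrix.rowAdjugate (Aᴴ * A))ᴴ * Aᴴ = Aᴴ * Matrix.rowAdjugate (A * Aᴴ) := by
    -- Each bracketing exposes one adjugate identity; both scalars are now the same nonzero
    -- determinant, which cancels.
    have h5 : (Matrix.rowAdjugate (Aᴴ * A))ᴴ * (Aᴴ * A) * (Aᴴ * Matrix.rowAdjugate (A * Aᴴ)) =
        (Matrix.rowAdjugate (Aᴴ * A))ᴴ * Aᴴ * (A * Aᴴ * Matrix.rowAdjugate (A * Aᴴ)) := by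
      simp only [mul_assoc]
    rw [h3, h1, smul_mul_assoc, one_mul, mul_smul_comm, mul_one] at h5
    exact (smul_right_injective _ hd h5).symm
  intro i j
  rw [Matrix.leftDoubleCofactor_eq, Matrix.rightDoubleCofactor_eq, h4]
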